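/- Let $d\ge 2$ be an integer, and let $R$ be a $[0,\infty)$-valued random variable with absolutely continuous distribution such that $\lim_{h\to\infty}h^{s}\,\mathbb{P}(R>h)=\beta$ for some $s,\beta\in(0,\infty)$. For an integer $n\ge1$ let $\mathbb{T}_n$ be the torus obtained from the cube $[-n/2,n/2]^d$ by identifying opposite faces, with toroidal (Euclidean) distance $\mathrm{d}_{\mathbb{T}_n}$ and origin $o$. Let $X^{(n)}$ and $X$ be independently $[0,\infty)$-marked homogeneous Poisson point processes with intensity $1$ on $\mathbb{T}_n$ and on $\mathbb{R}^d$, respectively, with marks distributed like $R$ (that is, Poisson point processes on $\mathbb{T}_n\times[0,\infty)$ and $\mathbb{R}^d\times[0,\infty)$ whose intensity measure is the product of Lebesgue measure and the distribution of $R$). Let $R^*$ be a copy of $R$ that is independent of $X^{(n)}$ (respectively of $X$). For $\alpha>0$ put $$D^{(\alpha)}_{\mathrm{out},n}=\sum_{(\xi,r)\in X^{(n)}}\mathrm{d}_{\mathbb{T}_n}(\xi,o)^{\alpha}\,\mathbf 1\{\mathrm{d}_{\mathbb{T}_n}(\xi,o)\le R^*\},\qquad D^{(\alpha)}_{\mathrm{out}}=\sum_{(\xi,r)\in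 X}|\xi|^{\alpha}\,\mathbf 1\{|\xi|\le R^*\}.$$ Then, for every $\alpha>0$, the random variables $D^{(\alpha)}_{\mathrm{out},n}$ ($n\ge 1$) and $D^{(\alpha)}_{\mathrm{out}}$ are almost surely finite, $D^{(\alpha)}_{\mathrm{out},n}$ converges in distribution to $D^{(\alpha)}_{\mathrm{out}}$ as $n\to\infty$, and $$\lim_{t\to\infty}t^{s/(\alpha+d)}\,\mathbb{P}\big(D^{(\alpha)}_{\mathrm{out}}>t\big)=\Big(\frac{d\,\kappa_d}{\alpha+d}\Big)^{s/(\alpha+d)}\beta,$$ where $\kappa_d$ is the volume of the unit ball in $\mathbb{R}^d$. -/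

import Mathlib

open MeasureTheory ProbabilityTheory Filter Topology
open scoped ENNReal NNReal

noncomputable section

/-- The measure that counts the points of a configuration `A`: for measurable `B`,
`countingMeasureOf A B` is the number (possibly `∞`) of points of `A` in `B`. -/
def countingMeasureOf {E : Type*} [MeasurableSpace E] (A : Set E) : Measure E :=
  Measure.sum fun p : A => Measure.dirac (p : E)

/-- `X` is a Poisson point process with (diffuse) intensity measure `Λ`, given as a random set of
points: the counts of points in measurable sets are random variables, the number of points in a
measurable set `B` of finite intensity is Poisson distributed with mean `Λ B`, and the numbers of
points in pairwise disjoint measurable sets are independent. -/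
structure IsPoissonProcess {Ω E : Type*} [MeasurableSpace Ω] [MeasurableSpace E]
    (X : Ω → Set E) (Λ : Measure E) (P : Measure Ω) : Prop where
  measurable_count : Measurable fun ω => countingMeasureOf (X ω)
  hasLaw_count : ∀ B : Set E, MeasurableSet B → Λ B ≠ ∞ →
    HasLaw (fun ω => countingMeasureOf (X ω) B)
      ((poissonMeasure (Λ B).toNNReal).map (fun k : ℕ => (k : ℝ≥0∞))) P
  indep_count : ∀ (m : ℕ) (B : Fin m → Set E), (∀ i, MeasurableSet (B i)) →
    (∀ i j, i ≠ j → Disjoint (B i) (B j)) →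
    iIndepFun (fun i ω => countingMeasureOf (X ω) (B i)) P

/-- `X` is an independently `[0,∞)`-marked homogeneous Poisson point process on `S` with
intensity `1` and mark distribution `ν`, i.e. a Poisson point process on `S × [0,∞)` whose
intensity measure is the product of the volume measure of `S` and `ν`. -/
def IsMarkedPoissonProcess {Ω S : Type*} [MeasurableSpace Ω] [MeasureSpace S]
    (X : Ω → Set (S × ℝ≥0)) (ν : Measure ℝ≥0) (P : Measure Ω) : Prop :=
  IsPoissonProcess X ((volume : Measure S).prod ν) P

instance fact_pnat_cast_pos (n : ℕ+) : Fact (0 < ((n : ℕ) : ℝ)) :=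
  ⟨Nat.cast_pos.mpr n.pos⟩

/-- The `d`-dimensional torus of side length `n`, i.e. `(ℝ / nℤ)^d`. Its volume measure is the
product of the Lebesgue measures of total mass `n` on the factors. -/
abbrev Torus (d : ℕ) (n : ℕ+) : Type := Fin d → AddCircle ((n : ℕ) : ℝ)

/-- The (Euclidean) toroidal distance; `dist` on a factor `ℝ / nℤ` is the distance
`min_{k ∈ ℤ} |x - y + k n|`. -/
def torusDist {d : ℕ} {n : ℕ+} (ξ η : Torus d n) : ℝ :=
  √(∑ i, dist (ξ i) (η i) ^ 2)

/-- The sum of `|ξ|^α` over all points `(ξ, r)` of the configuration `A` with `|ξ| ≤ ρ`, where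
`|ξ| = len ξ` is the distance from `ξ` to the origin. -/
def outEdgeSum {S : Type*} (len : S → ℝ) (α : ℝ) (A : Set (S × ℝ≥0)) (ρ : ℝ≥0) : ℝ≥0∞ :=
  ∑' p : A, if len (p : S × ℝ≥0).1 ≤ (ρ : ℝ)
    then ENNReal.ofReal (len (p : S × ℝ≥0).1 ^ α) else 0

/-- The power-weighted out-edge sum at the origin of the torus, for the configuration `A` of
marked points and the radius `ρ` attached to the origin. -/
def torusOutEdgeSum {d : ℕ} {n : ℕ+} (α : ℝ) (A : Set (Torus d n × ℝ≥0)) (ρ : ℝ≥0) : ℝ≥0∞ :=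
  outEdgeSum (fun ξ : Torus d n => torusDist ξ 0) α A ρ

/-- The power-weighted out-edge sum at the origin of `ℝ^d`. -/
def euclideanOutEdgeSum {d : ℕ} (α : ℝ) (A : Set (EuclideanSpace ℝ (Fin d) × ℝ≥0))
    (ρ : ℝ≥0) : ℝ≥0∞ :=
  outEdgeSum (fun ξ : EuclideanSpace ℝ (Fin d) => dist ξ 0) α A ρ

/-- The volume `κ_d` of the unit ball of `ℝ^d`. -/
def unitBallVolume (d : ℕ) : ℝ :=
  (volume : Measure (EuclideanSpace ℝ (Fin d))).real (Metric.closedBall 0 1)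

end

/-! Conditionally on the radius `ρ` at the origin, the out-edge sum is a Poisson sum of `|ξ| ^ α`
over the ball of radius `ρ`; the marks of the other points play no role. Everything rests on the
exponential formula `integral_exp_setIntegral`, proved for complex `z`: imaginary `z` yields
characteristic functions, real `z` yields exponential moments.

Convergence in distribution: by independence the characteristic function of the sum is a mixture
over `ρ` (`charFun_radialSum`). A ball of radius `ρ < n / 2` has the same distance distribution on
the torus and in space (`map_torusDist_eq`), so for fixed `ρ` the integrands agree for all large
`n`. Dominated convergence and Lévy's continuity theorem conclude.

Tail: given radius `ρ` the sum has mean `c ρ ^ (α + d)` with `c = d κ_d / (α + d)`. A Chernoff bound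
shows that a fixed relative deviation from this mean has probability exponentially small in `ρ ^ d`,
which is negligible against the polynomial tail of the radius. Hence the sum exceeds `c h ^ (α + d)`
essentially when the radius exceeds `h`. The bounds `euclideanOutEdgeSum_tail_le` and
`le_euclideanOutEdgeSum_tail` make this precise with radii `a h` and `b h`, where `a < 1 < b` are
arbitrarily close to `1`. -/

/-! ### The exponential formula for Poisson processes -/

section FloorSum

variable {E F : Type*} [MeasurableSpace E] [NormedAddCommGroup F] [NormedSpace ℝ F]

lemma measurableSet_floor_level {B : Set E} (hB : MeasurableSet B) {f : E → ℝ}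
    (hf : Measurable f) (k j : ℕ) : MeasurableSet (B ∩ {x | ⌊f x * k⌋₊ = j}) :=
  hB.inter ((Nat.measurable_floor.comp (hf.mul_const _)) (measurableSet_singleton j))

/-- The integral of a discretised function as a finite sum over its levels. -/
lemma sum_floor_level [CompleteSpace F] {μ : Measure E} {B : Set E} (hB : MeasurableSet B)
    (hμ : μ B ≠ ∞) {f : E → ℝ} (hf : Measurable f) {C : ℝ} (hC : ∀ x, f x ≤ C)
    (φ : ℝ → F) (k : ℕ) :
    ∑ j : Fin (⌊C * k⌋₊ + 1), μ.real (B ∩ {x | ⌊f x * k⌋₊ = j}) • φ ((j : ℕ) / k) =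
      ∫ x in B, φ ((⌊f x * k⌋₊ : ℝ) / k) ∂μ := by
  have hfin (j : ℕ) : μ (B ∩ {x | ⌊f x * k⌋₊ = j}) ≠ ∞ :=
    ne_top_of_le_ne_top hμ (measure_mono Set.inter_subset_left)
  have hm (j : ℕ) := measurableSet_floor_level hB hf k j
  calc
    _ = ∑ j : Fin (⌊C * k⌋₊ + 1), ∫ x, (B ∩ {x | ⌊f x * k⌋₊ = j}).indicator
          (fun _ => φ ((j : ℕ) / k)) x ∂μ := by
      refine Finset.sum_congr rfl fun j _ => ?_
      rw [integral_indicator_const _ (hm j)]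
    _ = ∫ x, ∑ j : Fin (⌊C * k⌋₊ + 1), (B ∩ {x | ⌊f x * k⌋₊ = j}).indicator
          (fun _ => φ ((j : ℕ) / k)) x ∂μ := by
      rw [integral_finsetSum]
      intro j _
      exact (integrable_indicator_iff (hm j)).2 (integrableOn_const (hfin j))
    _ = _ := by
      rw [← integral_indicator hB]
      congr 1 with x
      by_cases hx : x ∈ B
      · have hlt : ⌊f x * k⌋₊ < ⌊C * k⌋₊ + 1 :=
          Nat.lt_succ_of_le (Nat.floor_mono (mul_le_mul_of_nonneg_right (hC x) (by positivity)))
        rw [Finset.sum_eq_single (⟨⌊f x * k⌋₊, hlt⟩ : Fin (⌊C * k⌋₊ + 1))]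
        · simp [hx]
        · intro j _ hj
          refine Set.indicator_of_notMem (fun h => hj ?_) _
          exact Fin.ext h.2.symm
        · simp
      · simp [hx]

/-- The discretised values stay in `[0, C]`, where `φ` is bounded by compactness, so dominated
convergence applies. The measure is arbitrary because the lemma serves both for `Λ` and for a
realised counting measure. -/
lemma tendsto_integral_floor {μ : Measure E} {B : Set E}
    (hμ : μ B ≠ ∞) {f : E → ℝ} (hf : Measurable f) (hf0 : ∀ x, 0 ≤ f x) {C : ℝ}
    (hC : ∀ x, f x ≤ C) {φ : ℝ → F} (hφ : Continuous φ) :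
    Tendsto (fun k : ℕ => ∫ x in B, φ ((⌊f x * k⌋₊ : ℝ) / k) ∂μ) atTop
      (𝓝 (∫ x in B, φ (f x) ∂μ)) := by
  obtain ⟨M, hM⟩ := (isCompact_Icc (a := (0 : ℝ)) (b := C)).exists_bound_of_continuousOn
    hφ.continuousOn
  have : IsFiniteMeasure (μ.restrict B) := ⟨by simpa using hμ.lt_top⟩
  refine tendsto_integral_of_dominated_convergence (fun _ => M) (fun k => ?_)
    (integrable_const _) (fun k => ?_) ?_
  · have : Measurable fun x => (⌊f x * k⌋₊ : ℝ) :=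
      (measurable_of_countable _).comp (Nat.measurable_floor.comp (hf.mul_const _))
    exact hφ.comp_aestronglyMeasurable (this.div_const _).aestronglyMeasurable
  · refine .of_forall fun x => hM _ ⟨by positivity, ?_⟩
    refine le_trans ?_ (hC x)
    -- For `k = 0` the quotient is `0` by convention.
    rcases k.eq_zero_or_pos with rfl | hk
    · simpa using hf0 x
    · rw [div_le_iff₀ (by positivity)]
      exact Nat.floor_le (mul_nonneg (hf0 x) (by positivity))
  · refine .of_forall fun x => (hφ.tendsto _).comp ?_
    exact (tendsto_nat_floor_mul_div_atTop (hf0 x)).comp tendsto_natCast_atTop_atTop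

end FloorSum

/-- The exponential generating function of a Poisson random variable. -/
lemma integral_exp_mul_poissonMeasure (r : ℝ≥0) (z : ℂ) :
    Integrable (fun k : ℕ => Complex.exp (z * k)) (poissonMeasure r) ∧
      ∫ k : ℕ, Complex.exp (z * k) ∂(poissonMeasure r) = Complex.exp (r * (Complex.exp z - 1)) := by
  have key (k : ℕ) (w : ℂ) : Complex.exp (w * k) = Complex.exp w ^ k := by
    rw [mul_comm, Complex.exp_nat_mul]
  constructor
  · rw [integrable_poissonMeasure_iff]
    have := (NormedSpace.expSeries_div_summable (r * ‖Complex.exp z‖)).mul_left (Real.exp (-r))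
    refine this.congr fun k => ?_
    rw [key, norm_pow]
    ring
  · rw [integral_poissonMeasure]
    have := (NormedSpace.expSeries_div_hasSum_exp ((r : ℂ) * Complex.exp z)).mul_left
      (Complex.exp (-r))
    rw [← Complex.exp_eq_exp_ℂ, ← Complex.exp_add] at this
    rw [show (r : ℂ) * (Complex.exp z - 1) = -r + r * Complex.exp z by ring, ← this.tsum_eq]
    congr 1 with k
    rw [key, Complex.real_smul]
    push_cast
    ring

namespace IsPoissonProcess

variable {Ω E : Type*} [MeasurableSpace Ω] [MeasurableSpace E] {X : Ω → Set E} {Λ : Measure E}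
  {P : Measure Ω}

lemma measurable_count_apply (h : IsPoissonProcess X Λ P) {B : Set E} (hB : MeasurableSet B) :
    Measurable fun ω => countingMeasureOf (X ω) B :=
  (Measure.measurable_coe hB).comp h.measurable_count

lemma ae_count_ne_top (h : IsPoissonProcess X Λ P) {B : Set E} (hB : MeasurableSet B)
    (hΛ : Λ B ≠ ∞) : ∀ᵐ ω ∂P, countingMeasureOf (X ω) B ≠ ∞ := by
  have hl := h.hasLaw_count B hB hΛ
  refine ae_of_ae_map (p := fun x => x ≠ ∞) hl.aemeasurable ?_
  rw [hl.map_eq, ae_map_iff .of_discrete (p := fun x => x ≠ ∞) (measurableSet_singleton _).compl]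
  exact .of_forall fun k => ENNReal.natCast_ne_top k

/-- Besides the value, the integrability for every `z` matters: it supplies the dominating function
in the exponential formula. -/
lemma integral_exp_count (h : IsPoissonProcess X Λ P) {B : Set E} (hB : MeasurableSet B)
    (hΛ : Λ B ≠ ∞) (z : ℂ) :
    Integrable (fun ω => Complex.exp (z * (countingMeasureOf (X ω)).real B)) P ∧
      ∫ ω, Complex.exp (z * (countingMeasureOf (X ω)).real B) ∂P =
        Complex.exp (Λ.real B * (Complex.exp z - 1)) := by
  have hl := h.hasLaw_count B hB hΛ
  have hp := integral_exp_mul_poissonMeasure (Λ B).toNNReal z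
  have hm : Measurable fun x : ℝ≥0∞ => Complex.exp (z * (x.toReal : ℂ)) := by fun_prop
  constructor
  · have : Integrable (fun x : ℝ≥0∞ => Complex.exp (z * (x.toReal : ℂ)))
        (P.map fun ω => countingMeasureOf (X ω) B) := by
      rw [hl.map_eq, integrable_map_measure hm.aestronglyMeasurable .of_discrete]
      simpa [Function.comp_def] using hp.1
    exact this.comp_aemeasurable hl.aemeasurable
  · have := hl.integral_comp (f := fun x : ℝ≥0∞ => Complex.exp (z * (x.toReal : ℂ)))
      hm.aestronglyMeasurable
    rw [integral_map .of_discrete hm.aestronglyMeasurable] at this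
    have e : (((Λ B).toNNReal : ℝ) : ℂ) = (Λ.real B : ℂ) := rfl
    rw [e] at hp
    simpa [Function.comp_def, hp.2, measureReal_def] using this

/-- The exponential formula for the sum of `f` over the points of a Poisson process in `B`. -/
theorem integral_exp_setIntegral [IsProbabilityMeasure P] (h : IsPoissonProcess X Λ P)
    {B : Set E} (hB : MeasurableSet B) (hΛ : Λ B ≠ ∞) {f : E → ℝ} (hf : Measurable f)
    (hf0 : ∀ x, 0 ≤ f x) {C : ℝ} (hC : ∀ x, f x ≤ C) (z : ℂ) :
    ∫ ω, Complex.exp (z * (∫ x in B, f x ∂(countingMeasureOf (X ω)) : ℝ)) ∂P =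
      Complex.exp (∫ x in B, (Complex.exp (z * f x) - 1) ∂Λ) := by
  set N : Ω → Measure E := fun ω => countingMeasureOf (X ω) with hN
  have hfin := h.ae_count_ne_top hB hΛ
  let A (k j : ℕ) : Set E := B ∩ {x | ⌊f x * k⌋₊ = j}
  have hA (k j : ℕ) : MeasurableSet (A k j) := measurableSet_floor_level hB hf k j
  have hdisj (k : ℕ) (i j : ℕ) (hij : i ≠ j) : Disjoint (A k i) (A k j) :=
    Set.disjoint_left.2 fun x hx hy => hij (hx.2.symm.trans hy.2)
  let S (k : ℕ) (ω : Ω) : ℝ :=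
    ∑ j : Fin (⌊C * k⌋₊ + 1), (N ω).real (A k j) • (((j : ℕ) : ℝ) / k)
  have hSmeas (k : ℕ) : Measurable (S k) := by
    refine Finset.measurable_sum _ fun j _ => Measurable.smul_const ?_ _
    exact (h.measurable_count_apply (hA k j)).ennreal_toReal
  have hS (k : ℕ) : ∀ᵐ ω ∂P, S k ω = ∫ x in B, ((⌊f x * k⌋₊ : ℝ) / k) ∂(N ω) := by
    filter_upwards [hfin] with ω hω
    exact sum_floor_level hB hω hf hC (fun x : ℝ => x) k
  -- The level sets are disjoint, so their counts are independent Poisson variables and the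
  -- expectation factorises.
  have hexp (k : ℕ) : ∫ ω, Complex.exp (z * (S k ω : ℝ)) ∂P =
      Complex.exp (∫ x in B, (Complex.exp (z * ((⌊f x * k⌋₊ : ℝ) / k : ℝ)) - 1) ∂Λ) := by
    rw [← sum_floor_level hB hΛ hf hC (fun x : ℝ => Complex.exp (z * (x : ℂ)) - 1) k,
      Complex.exp_sum]
    have hind := h.indep_count (⌊C * k⌋₊ + 1) (fun j => A k j) (fun j => hA k j)
      (fun i j hij => hdisj k i j (fun h' => hij (Fin.ext h')))
    have := hind.integral_fun_prod_comp (𝕜 := ℂ)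
      (f := fun (j : Fin _) x => Complex.exp (z * ((j : ℕ) / k : ℝ) * (x.toReal : ℂ)))
      (fun j => (h.measurable_count_apply (hA k j)).aemeasurable)
      (fun j => Measurable.aestronglyMeasurable (by fun_prop))
    calc
      _ = ∫ ω, ∏ j : Fin (⌊C * k⌋₊ + 1),
            Complex.exp (z * ((j : ℕ) / k : ℝ) * ((N ω (A k j)).toReal : ℂ)) ∂P := by
        congr 1 with ω
        rw [← Complex.exp_sum]
        congr 1
        simp only [S, Complex.ofReal_sum, Finset.mul_sum]
        refine Finset.sum_congr rfl fun j _ => ?_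
        simp only [measureReal_def, smul_eq_mul, Complex.ofReal_mul]
        ring
      _ = _ := by
        rw [this]
        refine Finset.prod_congr rfl fun j _ => ?_
        rw [Complex.real_smul]
        exact (h.integral_exp_count (hA k j)
          (ne_top_of_le_ne_top hΛ (measure_mono Set.inter_subset_left)) _).2
  have hlim1 : Tendsto (fun k : ℕ => ∫ ω, Complex.exp (z * (S k ω : ℝ)) ∂P) atTop
      (𝓝 (∫ ω, Complex.exp (z * (∫ x in B, f x ∂(N ω) : ℝ)) ∂P)) := by
    -- Each discretised sum is at most `C` times the number of points in `B`, which has all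
    -- exponential moments.
    refine tendsto_integral_of_dominated_convergence
      (fun ω => Real.exp (‖z‖ * C * (N ω).real B)) (fun k => ?_) ?_ (fun k => ?_) ?_
    · have := hSmeas k
      exact Measurable.aestronglyMeasurable (by fun_prop)
    · have := (h.integral_exp_count hB hΛ ((‖z‖ * C : ℝ) : ℂ)).1.norm
      refine this.congr (.of_forall fun ω => ?_)
      beta_reduce
      rw [← Complex.ofReal_mul, Complex.norm_exp, Complex.ofReal_re]
    · filter_upwards [hS k, hfin] with ω hω hω'
      rw [Complex.norm_exp]
      refine Real.exp_le_exp.2 (((Complex.re_le_norm _).trans_eq (norm_mul _ _)).trans ?_)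
      rw [mul_assoc, Complex.norm_real, hω]
      refine mul_le_mul_of_nonneg_left ?_ (norm_nonneg _)
      refine norm_setIntegral_le_of_norm_le_const hω'.lt_top fun x _ => ?_
      rw [Real.norm_of_nonneg (by positivity)]
      refine le_trans ?_ (hC x)
      rcases k.eq_zero_or_pos with rfl | hk
      · simpa using hf0 x
      · rw [div_le_iff₀ (by positivity)]
        exact Nat.floor_le (mul_nonneg (hf0 x) (by positivity))
    · filter_upwards [ae_all_iff.2 hS, hfin] with ω hω hω'
      have := tendsto_integral_floor hω' hf hf0 hC (φ := fun x : ℝ => x) continuous_id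
      simp_rw [hω]
      have hc : Continuous fun x : ℝ => Complex.exp (z * (x : ℂ)) := by fun_prop
      exact (hc.tendsto _).comp this
  refine tendsto_nhds_unique hlim1 ?_
  simp_rw [hexp]
  exact (Complex.continuous_exp.tendsto _).comp (tendsto_integral_floor hΛ hf hf0 hC
    (φ := fun x : ℝ => Complex.exp (z * (x : ℂ)) - 1) (by fun_prop))

end IsPoissonProcess

/-! ### Power-weighted sums over the points within a given distance -/

section RadialSum

variable {E : Type*} [MeasurableSpace E]

/-- The integral of `g ^ α` over `{g ≤ ρ}`. -/
noncomputable def radialSum (g : E → ℝ) (α ρ : ℝ) (μ : Measure E) : ℝ≥0∞ :=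
  ∫⁻ x in {x | g x ≤ ρ}, ENNReal.ofReal (g x ^ α) ∂μ

lemma lintegral_countingMeasureOf (A : Set E) {f : E → ℝ≥0∞} (hf : Measurable f) :
    ∫⁻ x, f x ∂(countingMeasureOf A) = ∑' p : A, f p := by
  simp [countingMeasureOf, lintegral_sum_measure, lintegral_dirac' _ hf]

lemma outEdgeSum_eq_radialSum {S : Type*} [MeasurableSpace S] {len : S → ℝ} (hlen : Measurable len)
    (α : ℝ) (A : Set (S × ℝ≥0)) (ρ : ℝ≥0) :
    outEdgeSum len α A ρ = radialSum (fun x : S × ℝ≥0 => len x.1) α ρ (countingMeasureOf A) := by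
  have hs : MeasurableSet {x : S × ℝ≥0 | len x.1 ≤ ρ} :=
    measurableSet_le (by fun_prop) measurable_const
  rw [radialSum, ← lintegral_indicator hs, lintegral_countingMeasureOf]
  · simp [outEdgeSum, Set.indicator_apply]
  · exact Measurable.indicator (by fun_prop) hs

variable {g : E → ℝ} {α : ℝ}

lemma radialSum_mono {ρ σ : ℝ} (h : ρ ≤ σ) (μ : Measure E) :
    radialSum g α ρ μ ≤ radialSum g α σ μ :=
  lintegral_mono_set fun _ hx => le_trans hx h

lemma measurable_radialSum (hg : Measurable g) (ρ : ℝ) : Measurable (radialSum g α ρ) := by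
  have hs : MeasurableSet {x | g x ≤ ρ} := measurableSet_le hg measurable_const
  unfold radialSum
  simp_rw [← lintegral_indicator hs]
  exact Measure.measurable_lintegral (Measurable.indicator (by fun_prop) hs)

lemma radialSum_ne_top (hg0 : ∀ x, 0 ≤ g x) (hα : 0 ≤ α) {ρ : ℝ}
    {μ : Measure E} (hμ : μ {x | g x ≤ ρ} ≠ ∞) : radialSum g α ρ μ ≠ ∞ := by
  refine ne_top_of_le_ne_top (b := ENNReal.ofReal (ρ ^ α) * μ {x | g x ≤ ρ})
    (ENNReal.mul_ne_top ENNReal.ofReal_ne_top hμ) ?_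
  rw [← setLIntegral_const]
  exact setLIntegral_mono measurable_const fun x hx =>
    ENNReal.ofReal_le_ofReal (Real.rpow_le_rpow (hg0 x) hx hα)

/-- Truncating at `ρ` changes nothing on the domain of integration but makes the integrand globally
bounded, as `integral_exp_setIntegral` requires. -/
lemma toReal_radialSum (hg : Measurable g) (hg0 : ∀ x, 0 ≤ g x) (ρ : ℝ) (μ : Measure E) :
    (radialSum g α ρ μ).toReal = ∫ x in {x | g x ≤ ρ}, min (g x) ρ ^ α ∂μ := by
  have hs : MeasurableSet {x | g x ≤ ρ} := measurableSet_le hg measurable_const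
  have : ∫ x in {x | g x ≤ ρ}, min (g x) ρ ^ α ∂μ = ∫ x in {x | g x ≤ ρ}, g x ^ α ∂μ :=
    setIntegral_congr_fun hs fun x (hx : g x ≤ ρ) => by simp [hx]
  rw [this, integral_eq_lintegral_of_nonneg_ae (.of_forall fun x => Real.rpow_nonneg (hg0 x) _)
    (Measurable.aestronglyMeasurable (by fun_prop)), radialSum]

/-- A version of `radialSum` that is jointly measurable in the radius and the measure. -/
noncomputable def radialSumUpper (g : E → ℝ) (α : ℝ) (p : ℝ≥0 × Measure E) : ℝ≥0∞ :=
  ⨅ q : ℚ, if (p.1 : ℝ) < q then radialSum g α q p.2 else ∞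

lemma measurable_radialSumUpper (hg : Measurable g) : Measurable (radialSumUpper g α) := by
  refine Measurable.iInf fun q => Measurable.ite ?_ ?_ measurable_const
  · exact measurableSet_lt (by fun_prop) measurable_const
  · exact (measurable_radialSum hg _).comp measurable_snd

/-- The radial sum is right-continuous in the radius: it is the mass of `{g ≤ r}` under the measure
with density `g ^ α`, and finiteness on bounded levels permits continuity from above. The infimum
over rationals therefore recovers it. -/
lemma radialSumUpper_eq (hg : Measurable g) (hg0 : ∀ x, 0 ≤ g x) (hα : 0 ≤ α) {μ : Measure E}
    (hμ : ∀ k : ℕ, μ {x | g x ≤ k} ≠ ∞) (ρ : ℝ≥0) :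
    radialSumUpper g α (ρ, μ) = radialSum g α ρ μ := by
  refine le_antisymm ?_ (le_iInf fun q => ?_)
  · have hs (r : ℝ) : MeasurableSet {x | g x ≤ r} := measurableSet_le hg measurable_const
    let m : Measure E := μ.withDensity fun x => ENNReal.ofReal (g x ^ α)
    have hm (r : ℝ) : m {x | g x ≤ r} = radialSum g α r μ := withDensity_apply _ (hs r)
    have hlim := tendsto_measure_biInter_gt (μ := m) (s := fun r : ℝ => {x | g x ≤ r})
      (a := (ρ : ℝ)) (fun r _ => (hs r).nullMeasurableSet)
      (fun i j _ hij x hx => le_trans hx hij) (by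
        obtain ⟨k, hk⟩ := exists_nat_gt (ρ : ℝ)
        exact ⟨k, hk, by rw [hm]; exact radialSum_ne_top hg0 hα (hμ k)⟩)
    have hinter : ⋂ r > (ρ : ℝ), {x | g x ≤ r} = {x | g x ≤ ρ} := by
      ext x
      simp only [gt_iff_lt, Set.mem_iInter, Set.mem_ofPred_eq]
      exact ⟨fun h => le_of_forall_gt_imp_ge_of_dense h, fun h r hr => h.trans hr.le⟩
    rw [hinter, hm] at hlim
    refine le_of_forall_gt_imp_ge_of_dense fun c hc => ?_
    have hev := (hlim.eventually (gt_mem_nhds hc)).and self_mem_nhdsWithin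
    obtain ⟨r, hr, hr'⟩ := hev.exists
    obtain ⟨q, hq1, hq2⟩ := exists_rat_btwn hr'
    refine (iInf_le _ q).trans ?_
    simp only [hq1, if_true]
    refine (radialSum_mono hq2.le μ).trans ?_
    rw [← hm]
    exact hr.le
  · split_ifs with h
    · exact radialSum_mono (le_of_lt h) μ
    · exact le_top

end RadialSum

namespace IsPoissonProcess

variable {Ω E : Type*} [MeasurableSpace Ω] [MeasurableSpace E] {X : Ω → Set E} {Λ : Measure E}
  {P : Measure Ω} {g : E → ℝ} {α : ℝ}

/-- A single null set must serve all radii, since the radius will be random; integer radii suffice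
by monotonicity. -/
lemma ae_forall_count_ne_top (h : IsPoissonProcess X Λ P) (hg : Measurable g)
    (hΛ : ∀ r : ℝ, Λ {x | g x ≤ r} ≠ ∞) :
    ∀ᵐ ω ∂P, ∀ r : ℝ, countingMeasureOf (X ω) {x | g x ≤ r} ≠ ∞ := by
  have : ∀ᵐ ω ∂P, ∀ k : ℕ, countingMeasureOf (X ω) {x | g x ≤ k} ≠ ∞ :=
    ae_all_iff.2 fun k => h.ae_count_ne_top (measurableSet_le hg measurable_const) (hΛ k)
  filter_upwards [this] with ω hω r
  obtain ⟨k, hk⟩ := exists_nat_ge r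
  exact ne_top_of_le_ne_top (hω k) (measure_mono fun x hx => le_trans hx hk)

lemma ae_radialSum_ne_top (h : IsPoissonProcess X Λ P) (hg : Measurable g) (hg0 : ∀ x, 0 ≤ g x)
    (hα : 0 ≤ α) (hΛ : ∀ r : ℝ, Λ {x | g x ≤ r} ≠ ∞) :
    ∀ᵐ ω ∂P, ∀ r : ℝ, radialSum g α r (countingMeasureOf (X ω)) ≠ ∞ := by
  filter_upwards [h.ae_forall_count_ne_top hg hΛ] with ω hω r
  exact radialSum_ne_top hg0 hα (hω r)

lemma integral_exp_radialSum [IsProbabilityMeasure P] (h : IsPoissonProcess X Λ P)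
    (hg : Measurable g) (hg0 : ∀ x, 0 ≤ g x) (hα : 0 ≤ α) {ρ : ℝ} (hρ : 0 ≤ ρ)
    (hΛ : Λ {x | g x ≤ ρ} ≠ ∞) (z : ℂ) :
    ∫ ω, Complex.exp (z * ((radialSum g α ρ (countingMeasureOf (X ω))).toReal : ℝ)) ∂P =
      Complex.exp (∫ x in {x | g x ≤ ρ}, (Complex.exp (z * (g x ^ α : ℝ)) - 1) ∂Λ) := by
  have hs : MeasurableSet {x | g x ≤ ρ} := measurableSet_le hg measurable_const
  simp_rw [toReal_radialSum hg hg0]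
  rw [h.integral_exp_setIntegral hs hΛ (by fun_prop)
    (fun x => Real.rpow_nonneg (le_min (hg0 x) hρ) _) (C := ρ ^ α)
    (fun x => Real.rpow_le_rpow (le_min (hg0 x) hρ) (min_le_right _ _) hα)]
  congr 1
  refine setIntegral_congr_fun hs fun x (hx : g x ≤ ρ) => ?_
  simp [hx]

variable {ν : Measure ℝ≥0} {R : Ω → ℝ≥0}

lemma radialSum_ae_eq (h : IsPoissonProcess X Λ P) (hg : Measurable g) (hg0 : ∀ x, 0 ≤ g x)
    (hα : 0 ≤ α) (hΛ : ∀ r : ℝ, Λ {x | g x ≤ r} ≠ ∞) :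
    (fun ω => radialSum g α (R ω) (countingMeasureOf (X ω))) =ᵐ[P]
      fun ω => radialSumUpper g α (R ω, countingMeasureOf (X ω)) := by
  filter_upwards [h.ae_forall_count_ne_top hg hΛ] with ω hω
  exact (radialSumUpper_eq hg hg0 hα (fun k => hω k) _).symm

lemma aemeasurable_radialSum (h : IsPoissonProcess X Λ P) (hg : Measurable g)
    (hg0 : ∀ x, 0 ≤ g x) (hα : 0 ≤ α) (hΛ : ∀ r : ℝ, Λ {x | g x ≤ r} ≠ ∞)
    (hR : AEMeasurable R P) :
    AEMeasurable (fun ω => radialSum g α (R ω) (countingMeasureOf (X ω))) P :=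
  ((measurable_radialSumUpper hg).comp_aemeasurable
    (hR.prodMk h.measurable_count.aemeasurable)).congr (h.radialSum_ae_eq hg hg0 hα hΛ).symm

/-- The characteristic function of a radial sum with an independent random radius. -/
lemma charFun_radialSum [IsProbabilityMeasure P] (h : IsPoissonProcess X Λ P) (hg : Measurable g)
    (hg0 : ∀ x, 0 ≤ g x) (hα : 0 ≤ α) (hΛ : ∀ r : ℝ, Λ {x | g x ≤ r} ≠ ∞)
    (hR : HasLaw R ν P) (hind : IndepFun R (fun ω => countingMeasureOf (X ω)) P) (u : ℝ) :
    charFun (P.map fun ω => (radialSum g α (R ω) (countingMeasureOf (X ω))).toReal) u =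
      ∫ ρ : ℝ≥0, Complex.exp (∫ x in {x | g x ≤ ρ},
        (Complex.exp (u * Complex.I * (g x ^ α : ℝ)) - 1) ∂Λ) ∂ν := by
  have hN : AEMeasurable (fun ω => countingMeasureOf (X ω)) P := h.measurable_count.aemeasurable
  have : IsProbabilityMeasure ν := by
    rw [← hR.map_eq]; exact Measure.isProbabilityMeasure_map hR.aemeasurable
  have : IsProbabilityMeasure (P.map fun ω => countingMeasureOf (X ω)) :=
    Measure.isProbabilityMeasure_map hN
  have hmeas : Measurable fun p : ℝ≥0 × Measure E =>
      Complex.exp (u * Complex.I * ((radialSumUpper g α p).toReal : ℝ)) := by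
    have := measurable_radialSumUpper (α := α) hg
    fun_prop
  have hnorm (p : ℝ≥0 × Measure E) :
      ‖Complex.exp (u * Complex.I * ((radialSumUpper g α p).toReal : ℝ))‖ ≤ 1 := by
    rw [mul_right_comm, ← Complex.ofReal_mul, Complex.norm_exp_ofReal_mul_I]
  rw [charFun_apply_real,
    integral_map (h.aemeasurable_radialSum hg hg0 hα hΛ hR.aemeasurable).ennreal_toReal
      (Measurable.aestronglyMeasurable (by fun_prop))]
  calc
    _ = ∫ ω, (fun p : ℝ≥0 × Measure E =>
          Complex.exp (u * Complex.I * ((radialSumUpper g α p).toReal : ℝ)))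
            (R ω, countingMeasureOf (X ω)) ∂P := by
      refine integral_congr_ae ?_
      filter_upwards [h.radialSum_ae_eq (R := R) hg hg0 hα hΛ] with ω hω
      rw [hω]
      ring_nf
    _ = ∫ ρ, ∫ μ, Complex.exp (u * Complex.I * ((radialSumUpper g α (ρ, μ)).toReal : ℝ))
          ∂(P.map fun ω => countingMeasureOf (X ω)) ∂ν := by
      -- Independence turns the joint law of radius and configuration into a product, and Fubini
      -- applies to the jointly measurable version.
      rw [← integral_map (hR.aemeasurable.prodMk hN) hmeas.aestronglyMeasurable,
        hind.map_prod_eq_prod_map_map hR.aemeasurable hN, hR.map_eq, integral_prod]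
      exact Integrable.of_bound hmeas.aestronglyMeasurable 1 (.of_forall hnorm)
    _ = _ := by
      congr 1 with ρ
      have hmρ : Measurable fun μ : Measure E =>
          Complex.exp (u * Complex.I * ((radialSumUpper g α (ρ, μ)).toReal : ℝ)) :=
        hmeas.comp measurable_prodMk_left
      rw [integral_map hN hmρ.aestronglyMeasurable,
        ← h.integral_exp_radialSum hg hg0 hα ρ.coe_nonneg (hΛ ρ)]
      refine integral_congr_ae ?_
      filter_upwards [h.radialSum_ae_eq (R := fun _ => ρ) hg hg0 hα hΛ] with ω hω
      rw [← hω]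

end IsPoissonProcess

/-! ### Distances on the torus and in Euclidean space -/

section Product

variable {S : Type*} [MeasurableSpace S] {μ : Measure S} {ν : Measure ℝ≥0}
  [IsProbabilityMeasure ν] {len : S → ℝ}

lemma prod_setOf_len_le (r : ℝ) :
    μ.prod ν {x : S × ℝ≥0 | len x.1 ≤ r} = μ {ξ | len ξ ≤ r} := by
  have : {x : S × ℝ≥0 | len x.1 ≤ r} = {ξ | len ξ ≤ r} ×ˢ Set.univ := by ext; simp
  rw [this, Measure.prod_prod, measure_univ, mul_one]

/-- Marks integrate out, leaving only the distribution of distances. Comparing torus and space thus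
reduces to comparing two measures on the line. -/
lemma setIntegral_prod_len [SFinite μ] {F : Type*} [NormedAddCommGroup F] [NormedSpace ℝ F]
    (hlen : Measurable len) (r : ℝ) {f : ℝ → F} (hf : StronglyMeasurable f) :
    ∫ x in {x : S × ℝ≥0 | len x.1 ≤ r}, f (len x.1) ∂(μ.prod ν) =
      ∫ y, f y ∂((μ.restrict {ξ | len ξ ≤ r}).map len) := by
  have : {x : S × ℝ≥0 | len x.1 ≤ r} = {ξ | len ξ ≤ r} ×ˢ Set.univ := by ext; simp
  rw [this, ← Measure.prod_restrict, Measure.restrict_univ,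
    integral_fun_fst (fun ξ => f (len ξ)), integral_map hlen.aemeasurable hf.aestronglyMeasurable]
  simp

end Product

section Torus

variable {d : ℕ} {n : ℕ+}

lemma measurable_torusDist : Measurable fun ξ : Torus d n => torusDist ξ 0 := by
  unfold torusDist
  fun_prop

lemma torusDist_nonneg (ξ : Torus d n) : 0 ≤ torusDist ξ 0 := Real.sqrt_nonneg _

/-- A representative of absolute value at most half the period realises the quotient norm in each
coordinate. -/
lemma torusDist_coe {y : Fin d → ℝ} (hy : ∀ i, |y i| ≤ (n : ℕ) / 2) :
    torusDist (fun i => (y i : AddCircle ((n : ℕ) : ℝ))) 0 = ‖WithLp.toLp 2 y‖ := by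
  rw [torusDist, EuclideanSpace.norm_eq]
  congr 1
  refine Finset.sum_congr rfl fun i _ => ?_
  have hn : ((n : ℕ) : ℝ) ≠ 0 := Nat.cast_ne_zero.2 n.ne_zero
  rw [Pi.zero_apply, dist_zero_right, (AddCircle.norm_coe_eq_abs_iff _ hn).2 (by simpa using hy i)]
  simp

lemma measurePreserving_torus_mk (d : ℕ) (n : ℕ+) :
    MeasurePreserving (fun (y : Fin d → ℝ) i => (y i : AddCircle ((n : ℕ) : ℝ)))
      (volume.restrict (Set.univ.pi fun _ => Set.Ioc (-((n : ℕ) / 2 : ℝ)) ((n : ℕ) / 2)))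
      (volume : Measure (Torus d n)) := by
  have h := measurePreserving_pi (ι := Fin d) _ _
    (fun _ => AddCircle.measurePreserving_mk ((n : ℕ) : ℝ) (-((n : ℕ) / 2 : ℝ)))
  rw [show -((n : ℕ) / 2 : ℝ) + (n : ℕ) = (n : ℕ) / 2 by ring] at h
  rw [volume_pi, volume_pi, Measure.restrict_pi_pi]
  exact h

/-- Up to half the side length, distances on the torus are distributed like Euclidean distances. -/
lemma map_torusDist_eq (d : ℕ) (n : ℕ+) {r : ℝ} (hr : r < (n : ℕ) / 2) :
    ((volume : Measure (Torus d n)).restrict {ξ | torusDist ξ 0 ≤ r}).map (fun ξ => torusDist ξ 0) =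
      ((volume : Measure (EuclideanSpace ℝ (Fin d))).restrict {x | dist x 0 ≤ r}).map
        (fun x => dist x 0) := by
  have hmE : Measurable fun x : EuclideanSpace ℝ (Fin d) => dist x 0 := by fun_prop
  ext s hs
  have h1 := measurable_torusDist (d := d) (n := n) hs
  have h2 : MeasurableSet {ξ : Torus d n | torusDist ξ 0 ≤ r} :=
    measurableSet_le measurable_torusDist measurable_const
  have h3 : MeasurableSet {x : EuclideanSpace ℝ (Fin d) | dist x 0 ≤ r} :=
    measurableSet_le hmE measurable_const
  rw [Measure.map_apply measurable_torusDist hs, Measure.map_apply hmE hs,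
    Measure.restrict_apply h1, Measure.restrict_apply (hmE hs),
    ← (measurePreserving_torus_mk d n).measure_preimage (h1.inter h2).nullMeasurableSet,
    ← (PiLp.volume_preserving_toLp (Fin d)).measure_preimage ((hmE hs).inter h3).nullMeasurableSet,
    Measure.restrict_apply ((measurePreserving_torus_mk d n).measurable (h1.inter h2))]
  congr 1
  ext y
  simp only [Set.mem_inter_iff, Set.mem_preimage, Set.mem_ofPred_eq, Set.mem_univ_pi, Set.mem_Ioc,
    dist_zero_right]
  constructor
  · rintro ⟨⟨hys, hyr⟩, hc⟩
    rw [torusDist_coe fun i => abs_le.2 ⟨(hc i).1.le, (hc i).2⟩] at hys hyr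
    exact ⟨hys, hyr⟩
  · rintro ⟨hys, hyr⟩
    -- Coordinates are bounded by the norm, so the ball lies inside the fundamental cube.
    have hc (i : Fin d) : |y i| < (n : ℕ) / 2 := by
      have := PiLp.norm_apply_le (p := 2) (WithLp.toLp 2 y) i
      exact (this.trans hyr).trans_lt hr
    rw [torusDist_coe fun i => (hc i).le]
    exact ⟨⟨hys, hyr⟩, fun i => ⟨(abs_lt.1 (hc i)).1, (abs_lt.1 (hc i)).2.le⟩⟩

end Torus

/-! ### Convergence in distribution via characteristic functions. -/

lemma measurable_exp_setIntegral {E : Type*} [MeasurableSpace E] {Λ : Measure E} [SFinite Λ]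
    {g : E → ℝ} (hg : Measurable g) {f : E → ℂ} (hf : Measurable f) :
    Measurable fun ρ : ℝ≥0 => Complex.exp (∫ x in {x | g x ≤ ρ}, f x ∂Λ) := by
  have hs (ρ : ℝ≥0) : MeasurableSet {x | g x ≤ ρ} := measurableSet_le hg measurable_const
  simp_rw [← integral_indicator (hs _)]
  refine Complex.measurable_exp.comp (StronglyMeasurable.measurable ?_)
  refine StronglyMeasurable.integral_prod_right
    (f := fun (ρ : ℝ≥0) (x : E) => {x | g x ≤ ρ}.indicator f x) ?_
  refine Measurable.stronglyMeasurable ?_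
  have : MeasurableSet {p : ℝ≥0 × E | g p.2 ≤ p.1} := measurableSet_le (by fun_prop) (by fun_prop)
  exact Measurable.indicator (f := fun p : ℝ≥0 × E => f p.2) (by fun_prop) this

/-- By the exponential formula this is a value of a characteristic function. -/
lemma IsPoissonProcess.norm_exp_setIntegral_le {Ω E : Type*} [MeasurableSpace Ω]
    [MeasurableSpace E] {X : Ω → Set E} {Λ : Measure E} {P : Measure Ω} [IsProbabilityMeasure P]
    (h : IsPoissonProcess X Λ P) {g : E → ℝ} {α : ℝ} (hg : Measurable g) (hg0 : ∀ x, 0 ≤ g x)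
    (hα : 0 ≤ α) {ρ : ℝ} (hρ : 0 ≤ ρ) (hΛ : Λ {x | g x ≤ ρ} ≠ ∞) (u : ℝ) :
    ‖Complex.exp (∫ x in {x | g x ≤ ρ},
      (Complex.exp (u * Complex.I * (g x ^ α : ℝ)) - 1) ∂Λ)‖ ≤ 1 := by
  rw [← h.integral_exp_radialSum hg hg0 hα hρ hΛ]
  refine (norm_integral_le_of_norm_le_const (C := 1) (.of_forall fun ω => ?_)).trans (by simp)
  rw [mul_right_comm, ← Complex.ofReal_mul, Complex.norm_exp_ofReal_mul_I]

lemma tendsto_probabilityMeasure_of_tendsto_charFun_pnat {μ : ℕ+ → ProbabilityMeasure ℝ}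
    {μ₀ : ProbabilityMeasure ℝ}
    (h : ∀ u : ℝ, Tendsto (fun n => charFun (μ n : Measure ℝ) u) atTop
      (𝓝 (charFun (μ₀ : Measure ℝ) u))) : Tendsto μ atTop (𝓝 μ₀) := by
  have hsucc : Tendsto Nat.succPNat atTop atTop :=
    tendsto_atTop_mono (fun n => (show n.succPNat ≥ n.succPNat from le_rfl))
      OrderIso.pnatIsoNat.symm.tendsto_atTop
  have hpred : Tendsto PNat.natPred atTop atTop := OrderIso.pnatIsoNat.tendsto_atTop
  have := ProbabilityMeasure.tendsto_of_tendsto_charFun (μ := μ ∘ Nat.succPNat) (μ₀ := μ₀)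
    fun u => (h u).comp hsucc
  refine (this.comp hpred).congr fun n => ?_
  simp

section Convergence

variable {d : ℕ} {ν : Measure ℝ≥0} [IsProbabilityMeasure ν] {α : ℝ}

lemma prod_setOf_torusDist_le_ne_top {n : ℕ+} (r : ℝ) :
    ((volume : Measure (Torus d n)).prod ν) {x | torusDist x.1 0 ≤ r} ≠ ∞ := by
  rw [prod_setOf_len_le (len := fun ξ : Torus d n => torusDist ξ 0)]
  exact measure_ne_top _ _

lemma prod_setOf_dist_le_ne_top (r : ℝ) :
    ((volume : Measure (EuclideanSpace ℝ (Fin d))).prod ν) {x | dist x.1 0 ≤ r} ≠ ∞ := by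
  rw [prod_setOf_len_le (len := fun ξ : EuclideanSpace ℝ (Fin d) => dist ξ 0)]
  exact (measure_closedBall_lt_top (x := (0 : EuclideanSpace ℝ (Fin d))) (r := r)).ne

theorem tendstoInDistribution_torusOutEdgeSum
    {Ω : ℕ+ → Type*} [∀ n, MeasurableSpace (Ω n)] {P : ∀ n, Measure (Ω n)}
    [∀ n, IsProbabilityMeasure (P n)]
    {X : ∀ n, Ω n → Set (Torus d n × ℝ≥0)} (hX : ∀ n, IsMarkedPoissonProcess (X n) ν (P n))
    {R : ∀ n, Ω n → ℝ≥0} (hR : ∀ n, HasLaw (R n) ν (P n))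
    (hRX : ∀ n, IndepFun (R n) (fun ω => countingMeasureOf (X n ω)) (P n))
    {Ω' : Type*} [MeasurableSpace Ω'] {P' : Measure Ω'} [IsProbabilityMeasure P']
    {X' : Ω' → Set (EuclideanSpace ℝ (Fin d) × ℝ≥0)} (hX' : IsMarkedPoissonProcess X' ν P')
    {R' : Ω' → ℝ≥0} (hR' : HasLaw R' ν P')
    (hRX' : IndepFun R' (fun ω => countingMeasureOf (X' ω)) P') (hα : 0 ≤ α) :
    TendstoInDistribution (fun n ω => (torusOutEdgeSum α (X n ω) (R n ω)).toReal) atTop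
      (fun ω => (euclideanOutEdgeSum α (X' ω) (R' ω)).toReal) P P' := by
  have hT (n : ℕ+) : Measurable fun x : Torus d n × ℝ≥0 => torusDist x.1 0 :=
    measurable_torusDist.comp measurable_fst
  have hE : Measurable fun x : EuclideanSpace ℝ (Fin d) × ℝ≥0 => dist x.1 0 := by fun_prop
  have hEd : Measurable fun x : EuclideanSpace ℝ (Fin d) => dist x 0 := by fun_prop
  have eT (n : ℕ+) : (fun ω => (torusOutEdgeSum α (X n ω) (R n ω)).toReal) = fun ω =>
      (radialSum (fun x : Torus d n × ℝ≥0 => torusDist x.1 0) α (R n ω)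
        (countingMeasureOf (X n ω))).toReal := by
    ext ω
    rw [torusOutEdgeSum, outEdgeSum_eq_radialSum measurable_torusDist]
  have eE : (fun ω => (euclideanOutEdgeSum α (X' ω) (R' ω)).toReal) = fun ω =>
      (radialSum (fun x : EuclideanSpace ℝ (Fin d) × ℝ≥0 => dist x.1 0) α (R' ω)
        (countingMeasureOf (X' ω))).toReal := by
    ext ω
    rw [euclideanOutEdgeSum, outEdgeSum_eq_radialSum hEd]
  have mT (n : ℕ+) : AEMeasurable (fun ω => (torusOutEdgeSum α (X n ω) (R n ω)).toReal) (P n) := by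
    rw [eT]
    exact (IsPoissonProcess.aemeasurable_radialSum (hX n) (hT n) (fun _ => torusDist_nonneg _) hα
      prod_setOf_torusDist_le_ne_top (hR n).aemeasurable).ennreal_toReal
  have mE : AEMeasurable (fun ω => (euclideanOutEdgeSum α (X' ω) (R' ω)).toReal) P' := by
    rw [eE]
    exact (IsPoissonProcess.aemeasurable_radialSum hX' hE (fun _ => dist_nonneg) hα
      prod_setOf_dist_le_ne_top hR'.aemeasurable).ennreal_toReal
  refine ⟨mT, mE, tendsto_probabilityMeasure_of_tendsto_charFun_pnat fun u => ?_⟩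
  simp only [ProbabilityMeasure.coe_mk]
  rw [eE, IsPoissonProcess.charFun_radialSum hX' hE (fun _ => dist_nonneg) hα
    prod_setOf_dist_le_ne_top hR' hRX']
  simp_rw [eT, fun n => IsPoissonProcess.charFun_radialSum (hX n) (hT n)
    (fun _ => torusDist_nonneg _) hα prod_setOf_torusDist_le_ne_top (hR n) (hRX n) u]
  refine tendsto_integral_filter_of_dominated_convergence (fun _ => 1) (.of_forall fun n => ?_)
    (.of_forall fun n => .of_forall fun ρ => ?_) (integrable_const _) (.of_forall fun ρ => ?_)
  · have := hT n
    exact (measurable_exp_setIntegral (hT n) (by fun_prop)).aestronglyMeasurable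
  · exact IsPoissonProcess.norm_exp_setIntegral_le (hX n) (hT n) (fun _ => torusDist_nonneg _) hα
      ρ.coe_nonneg (prod_setOf_torusDist_le_ne_top _) u
  -- For fixed `ρ` the integrands are equal to the limit as soon as `n > 2 ρ`.
  · refine tendsto_const_nhds.congr' ?_
    obtain ⟨m, hm⟩ := exists_nat_gt (2 * (ρ : ℝ))
    filter_upwards [eventually_ge_atTop m.succPNat] with n hn
    have hn' : (ρ : ℝ) < (n : ℕ) / 2 := by
      have h1 : (m.succPNat : ℕ) ≤ n := hn
      have h2 : (m : ℝ) ≤ (n : ℕ) := by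
        exact_mod_cast (Nat.le_succ m).trans h1
      linarith
    have hf : StronglyMeasurable fun y : ℝ =>
        Complex.exp (u * Complex.I * (y ^ α : ℝ)) - 1 := Measurable.stronglyMeasurable (by fun_prop)
    rw [setIntegral_prod_len (len := fun ξ : Torus d n => torusDist ξ 0) measurable_torusDist ρ hf,
      setIntegral_prod_len (len := fun ξ : EuclideanSpace ℝ (Fin d) => dist ξ 0) hEd ρ hf,
      map_torusDist_eq d n hn']

end Convergence

/-! ### Concentration of radial sums -/

namespace IsPoissonProcess

variable {Ω E : Type*} [MeasurableSpace Ω] [MeasurableSpace E] {X : Ω → Set E} {Λ : Measure E}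
  {P : Measure Ω} [IsProbabilityMeasure P] {g : E → ℝ} {α : ℝ}

/-- This is the exponential formula at real `z`. Integrability comes for free: a non-integrable
function would have integral `0`, not an exponential. -/
lemma mgf_radialSum (h : IsPoissonProcess X Λ P) (hg : Measurable g) (hg0 : ∀ x, 0 ≤ g x)
    (hα : 0 ≤ α) {ρ : ℝ} (hρ : 0 ≤ ρ) (hΛ : Λ {x | g x ≤ ρ} ≠ ∞) (t : ℝ) :
    Integrable (fun ω =>
      Real.exp (t * (radialSum g α ρ (countingMeasureOf (X ω))).toReal)) P ∧
    mgf (fun ω => (radialSum g α ρ (countingMeasureOf (X ω))).toReal) P t =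
      Real.exp (∫ x in {x | g x ≤ ρ}, (Real.exp (t * g x ^ α) - 1) ∂Λ) := by
  have key := h.integral_exp_radialSum hg hg0 hα hρ hΛ (t : ℂ)
  have e1 : (fun x => Complex.exp (t * (g x ^ α : ℝ)) - 1) =
      fun x => ((Real.exp (t * g x ^ α) - 1 : ℝ) : ℂ) := by
    ext x; push_cast; rfl
  have e2 : (fun ω => Complex.exp
      (t * ((radialSum g α ρ (countingMeasureOf (X ω))).toReal : ℝ))) = fun ω =>
      ((Real.exp (t * (radialSum g α ρ (countingMeasureOf (X ω))).toReal) : ℝ) : ℂ) := by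
    ext x; push_cast; rfl
  rw [e1, e2, integral_complex_ofReal, integral_complex_ofReal, ← Complex.ofReal_exp,
    Complex.ofReal_inj] at key
  refine ⟨Integrable.of_integral_ne_zero ?_, key⟩
  rw [key]
  exact Real.exp_ne_zero _

/-- With `y = g ^ α / ρ ^ α` in `[0, 1]` and `|t| ≤ 1`, one has `exp (t y) - 1 ≤ t y + t ^ 2 y ^ 2 ≤
(t + t ^ 2) y`. -/
lemma mgf_radialSum_le (h : IsPoissonProcess X Λ P) (hg : Measurable g) (hg0 : ∀ x, 0 ≤ g x)
    (hα : 0 ≤ α) {ρ : ℝ} (hρ : 0 < ρ) (hΛ : Λ {x | g x ≤ ρ} ≠ ∞) {t : ℝ} (ht : |t| ≤ 1) :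
    mgf (fun ω => (radialSum g α ρ (countingMeasureOf (X ω))).toReal) P (t / ρ ^ α) ≤
      Real.exp ((t + t ^ 2) * ((∫ x in {x | g x ≤ ρ}, g x ^ α ∂Λ) / ρ ^ α)) := by
  have hs : MeasurableSet {x | g x ≤ ρ} := measurableSet_le hg measurable_const
  have hρα : 0 < ρ ^ α := Real.rpow_pos_of_pos hρ α
  have : IsFiniteMeasure (Λ.restrict {x | g x ≤ ρ}) := ⟨by simpa using hΛ.lt_top⟩
  have hy0 (x : E) : 0 ≤ g x ^ α / ρ ^ α := div_nonneg (Real.rpow_nonneg (hg0 x) _) hρα.le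
  have hy1 {x : E} (hx : g x ≤ ρ) : g x ^ α / ρ ^ α ≤ 1 :=
    (div_le_one hρα).2 (Real.rpow_le_rpow (hg0 x) hx hα)
  have hbound {x : E} (hx : g x ≤ ρ) : |t * (g x ^ α / ρ ^ α)| ≤ 1 := by
    rw [abs_mul, abs_of_nonneg (hy0 x)]
    exact mul_le_one₀ ht (hy0 x) (hy1 hx)
  have hint : IntegrableOn (fun x => g x ^ α) {x | g x ≤ ρ} Λ := by
    refine Integrable.of_bound (Measurable.aestronglyMeasurable (by fun_prop)) (ρ ^ α)
      ((ae_restrict_iff' hs).2 (.of_forall fun x hx => ?_))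
    rw [Real.norm_of_nonneg (Real.rpow_nonneg (hg0 x) _)]
    exact Real.rpow_le_rpow (hg0 x) hx hα
  rw [(h.mgf_radialSum hg hg0 hα hρ.le hΛ _).2]
  refine Real.exp_le_exp.2 ?_
  rw [← integral_div, ← integral_const_mul]
  have hle {x : E} (hx : g x ≤ ρ) : |Real.exp (t / ρ ^ α * g x ^ α) - 1 - t * (g x ^ α / ρ ^ α)| ≤
      t ^ 2 * (g x ^ α / ρ ^ α) := by
    rw [div_mul_eq_mul_div, mul_div_assoc]
    refine (Real.abs_exp_sub_one_sub_id_le (hbound hx)).trans ?_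
    rw [mul_pow]
    refine mul_le_mul_of_nonneg_left ?_ (sq_nonneg t)
    rw [sq]
    exact mul_le_of_le_one_left (hy0 x) (hy1 hx)
  refine setIntegral_mono_on ?_ ((hint.div_const _).const_mul _) hs fun x hx => ?_
  · refine Integrable.of_bound (Measurable.aestronglyMeasurable (by fun_prop)) (1 + t ^ 2)
      ((ae_restrict_iff' hs).2 (.of_forall fun x hx => ?_))
    have h1 := abs_le.1 (hle hx)
    have h2 := abs_le.1 (hbound hx)
    have h3 : t ^ 2 * (g x ^ α / ρ ^ α) ≤ t ^ 2 := mul_le_of_le_one_right (sq_nonneg t) (hy1 hx)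
    rw [Real.norm_eq_abs, abs_le]
    constructor <;> linarith
  · have := (abs_le.1 (hle hx)).2
    linarith

lemma measureReal_radialSum_ge_le (h : IsPoissonProcess X Λ P) (hg : Measurable g)
    (hg0 : ∀ x, 0 ≤ g x) (hα : 0 ≤ α) {ρ : ℝ} (hρ : 0 < ρ) (hΛ : Λ {x | g x ≤ ρ} ≠ ∞) {δ : ℝ}
    (hδ0 : 0 ≤ δ) (hδ : δ ≤ 2) :
    P.real {ω | (1 + δ) * ∫ x in {x | g x ≤ ρ}, g x ^ α ∂Λ ≤
      (radialSum g α ρ (countingMeasureOf (X ω))).toReal} ≤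
    Real.exp (-(δ ^ 2 / 4 * ((∫ x in {x | g x ≤ ρ}, g x ^ α ∂Λ) / ρ ^ α))) := by
  have hρα : 0 < ρ ^ α := Real.rpow_pos_of_pos hρ α
  -- Chernoff with `t = δ / 2`, the minimiser of `t + t ^ 2 - t (1 + δ)`, whose minimum is `-δ ^ 2 /
  -- 4`; `δ ≤ 2` keeps `|t| ≤ 1`.
  refine (measure_ge_le_exp_mul_mgf (t := δ / 2 / ρ ^ α) _ (by positivity)
    (h.mgf_radialSum hg hg0 hα hρ.le hΛ _).1).trans ?_
  refine (mul_le_mul_of_nonneg_left (h.mgf_radialSum_le hg hg0 hα hρ hΛ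
    (abs_le.2 ⟨by linarith, by linarith⟩)) (Real.exp_nonneg _)).trans_eq ?_
  rw [← Real.exp_add]
  congr 1
  ring

lemma measureReal_radialSum_le_le (h : IsPoissonProcess X Λ P) (hg : Measurable g)
    (hg0 : ∀ x, 0 ≤ g x) (hα : 0 ≤ α) {ρ : ℝ} (hρ : 0 < ρ) (hΛ : Λ {x | g x ≤ ρ} ≠ ∞) {δ : ℝ}
    (hδ0 : 0 ≤ δ) (hδ : δ ≤ 2) :
    P.real {ω | (radialSum g α ρ (countingMeasureOf (X ω))).toReal ≤
      (1 - δ) * ∫ x in {x | g x ≤ ρ}, g x ^ α ∂Λ} ≤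
    Real.exp (-(δ ^ 2 / 4 * ((∫ x in {x | g x ≤ ρ}, g x ^ α ∂Λ) / ρ ^ α))) := by
  have hρα : 0 < ρ ^ α := Real.rpow_pos_of_pos hρ α
  refine (measure_le_le_exp_mul_mgf (t := -(δ / 2) / ρ ^ α) _
    (div_nonpos_of_nonpos_of_nonneg (by linarith) hρα.le)
    (h.mgf_radialSum hg hg0 hα hρ.le hΛ _).1).trans ?_
  refine (mul_le_mul_of_nonneg_left (h.mgf_radialSum_le hg hg0 hα hρ hΛ
    (abs_le.2 ⟨by linarith, by linarith⟩)) (Real.exp_nonneg _)).trans_eq ?_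
  rw [← Real.exp_add]
  congr 1
  ring

end IsPoissonProcess

/-! ### The tail of the out-edge sum in Euclidean space -/

lemma unitBallVolume_pos (d : ℕ) : 0 < unitBallVolume d :=
  ENNReal.toReal_pos (Metric.measure_closedBall_pos _ _ one_pos).ne'
    measure_closedBall_lt_top.ne

/-- Polar coordinates reduce this to integrating `y ^ (α + d - 1)` over `(0, ρ]`. -/
lemma setIntegral_norm_rpow {d : ℕ} (hd : 0 < d) {α : ℝ} (hα : 0 ≤ α) {ρ : ℝ} (hρ : 0 ≤ ρ) :
    ∫ x in {x : EuclideanSpace ℝ (Fin d) | dist x 0 ≤ ρ}, dist x 0 ^ α =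
      d * unitBallVolume d / (α + d) * ρ ^ (α + d) := by
  have hfr : Module.finrank ℝ (EuclideanSpace ℝ (Fin d)) = d := finrank_euclideanSpace_fin
  have : Nontrivial (EuclideanSpace ℝ (Fin d)) :=
    Module.nontrivial_of_finrank_pos (R := ℝ) (by rw [hfr]; exact hd)
  have hs : MeasurableSet {x : EuclideanSpace ℝ (Fin d) | dist x 0 ≤ ρ} :=
    measurableSet_le (by fun_prop) measurable_const
  have hvol : (volume : Measure (EuclideanSpace ℝ (Fin d))).real (Metric.ball 0 1) =
      unitBallVolume d := by
    rw [unitBallVolume, measureReal_def, measureReal_def,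
      Measure.addHaar_closedBall_eq_addHaar_ball]
  have hd1 : ((d - 1 : ℕ) : ℝ) = d - 1 := by
    rw [Nat.cast_sub hd, Nat.cast_one]
  have hd1' : (1 : ℝ) ≤ d := by exact_mod_cast hd
  calc
    _ = ∫ x : EuclideanSpace ℝ (Fin d), (Set.Iic ρ).indicator (fun y => y ^ α) ‖x‖ := by
      rw [← integral_indicator hs]
      congr 1 with x
      simp [Set.indicator_apply]
    _ = d * unitBallVolume d * ∫ y in Set.Ioi (0 : ℝ),
          y ^ (d - 1) * (Set.Iic ρ).indicator (fun y => y ^ α) y := by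
      rw [integral_fun_norm_addHaar, hfr, hvol]
      simp [mul_assoc]
    _ = d * unitBallVolume d * ∫ y in Set.Ioc 0 ρ, y ^ (α + d - 1) := by
      congr 1
      rw [← integral_indicator measurableSet_Ioi, ← integral_indicator measurableSet_Ioc]
      congr 1 with y
      by_cases h0 : 0 < y
      · by_cases h1 : y ≤ ρ
        · simp only [Set.indicator_apply, Set.mem_Ioi, h0, Set.mem_Iic, h1, Set.mem_Ioc, if_true,
            and_self]
          rw [← Real.rpow_natCast, ← Real.rpow_add h0, hd1]
          congr 1
          ring
        · simp [h0, h1]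
      · simp [h0]
    _ = _ := by
      rw [← intervalIntegral.integral_of_le hρ, integral_rpow (Or.inl (by linarith)),
        sub_add_cancel, Real.zero_rpow (by positivity)]
      ring

section Tail

variable {d : ℕ} {ν : Measure ℝ≥0} {s β α : ℝ}
  {Ω : Type*} [MeasurableSpace Ω] {P : Measure Ω} [IsProbabilityMeasure P]
  {X : Ω → Set (EuclideanSpace ℝ (Fin d) × ℝ≥0)} {R : Ω → ℝ≥0}

lemma setIntegral_prod_norm_rpow [IsProbabilityMeasure ν] (hd : 0 < d) (hα : 0 ≤ α) {ρ : ℝ} (hρ : 0 ≤ ρ) :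
    ∫ x in {x : EuclideanSpace ℝ (Fin d) × ℝ≥0 | dist x.1 0 ≤ ρ}, dist x.1 0 ^ α
      ∂((volume : Measure (EuclideanSpace ℝ (Fin d))).prod ν) =
      d * unitBallVolume d / (α + d) * ρ ^ (α + d) := by
  have hf : StronglyMeasurable fun y : ℝ => y ^ α := Measurable.stronglyMeasurable (by fun_prop)
  have hE : Measurable fun x : EuclideanSpace ℝ (Fin d) => dist x 0 := by fun_prop
  rw [setIntegral_prod_len (len := fun x : EuclideanSpace ℝ (Fin d) => dist x 0) hE ρ hf,
    integral_map hE.aemeasurable hf.aestronglyMeasurable]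
  exact setIntegral_norm_rpow hd hα hρ

lemma tendsto_rpow_mul_tail
    (htail : Tendsto (fun h : ℝ => h ^ s * ν.real {r : ℝ≥0 | h < (r : ℝ)}) atTop (𝓝 β))
    {b : ℝ} (hb : 0 < b) :
    Tendsto (fun h : ℝ => h ^ s * ν.real {r : ℝ≥0 | b * h < (r : ℝ)}) atTop
      (𝓝 (b ^ (-s) * β)) := by
  refine ((htail.comp (tendsto_id.const_mul_atTop hb)).const_mul (b ^ (-s))).congr' ?_
  filter_upwards [eventually_gt_atTop 0] with h hh
  simp only [Function.comp_apply, id_eq]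
  rw [Real.mul_rpow hb.le hh.le, ← mul_assoc, ← mul_assoc, ← Real.rpow_add hb]
  simp

lemma tendsto_rpow_mul_exp_neg_mul_pow (s : ℝ) {K : ℝ} (hK : 0 < K) (hd : 0 < d) :
    Tendsto (fun h : ℝ => h ^ s * Real.exp (-(K * h ^ d))) atTop (𝓝 0) := by
  refine squeeze_zero' ?_ ?_ (tendsto_rpow_mul_exp_neg_mul_atTop_nhds_zero s K hK)
  · filter_upwards [eventually_ge_atTop 0] with h hh
    exact mul_nonneg (Real.rpow_nonneg hh _) (Real.exp_nonneg _)
  · filter_upwards [eventually_ge_atTop 1] with h hh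
    refine mul_le_mul_of_nonneg_left (Real.exp_le_exp.2 ?_) (Real.rpow_nonneg (by linarith) _)
    have : h ≤ h ^ d := le_self_pow₀ hh hd.ne'
    nlinarith

lemma exists_lt_one_rpow_neg_mul_lt {y : ℝ} (hy : β < y) (s : ℝ) :
    ∃ a : ℝ, 0 < a ∧ a < 1 ∧ a ^ (-s) * β < y := by
  have hc : ContinuousAt (fun a : ℝ => a ^ (-s) * β) 1 :=
    (Real.continuousAt_rpow_const 1 (-s) (Or.inl one_ne_zero)).mul_const β
  have h1 := (hc.eventually_lt_const (by simpa using hy)).filter_mono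
    (nhdsWithin_le_nhds (s := Set.Iio 1))
  obtain ⟨a, ha, ha0, ha1⟩ := (h1.and (Ioo_mem_nhdsLT (zero_lt_one' ℝ))).exists
  exact ⟨a, ha0, ha1, ha⟩

lemma exists_one_lt_lt_rpow_neg_mul {y : ℝ} (hy : y < β) (s : ℝ) :
    ∃ b : ℝ, 1 < b ∧ y < b ^ (-s) * β := by
  have hc : ContinuousAt (fun a : ℝ => a ^ (-s) * β) 1 :=
    (Real.continuousAt_rpow_const 1 (-s) (Or.inl one_ne_zero)).mul_const β
  have h1 := (hc.eventually_const_lt (by simpa using hy)).filter_mono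
    (nhdsWithin_le_nhds (s := Set.Ioi 1))
  obtain ⟨b, hb, hb1⟩ := (h1.and self_mem_nhdsWithin).exists
  exact ⟨b, hb1, hb⟩

end Tail

lemma measureReal_lt_radius {Ω : Type*} [MeasurableSpace Ω] {P : Measure Ω} {ν : Measure ℝ≥0}
    {R : Ω → ℝ≥0} (hR : HasLaw R ν P) (c : ℝ) :
    P.real {ω | c < R ω} = ν.real {r : ℝ≥0 | c < (r : ℝ)} :=
  hR.measureReal_eq (p := fun r : ℝ≥0 => c < (r : ℝ))
    (measurableSet_lt measurable_const (by fun_prop))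

section EuclideanTail

variable {d : ℕ} {ν : Measure ℝ≥0} [IsProbabilityMeasure ν] {s β α : ℝ}
  {Ω : Type*} [MeasurableSpace Ω] {P : Measure Ω} [IsProbabilityMeasure P]
  {X : Ω → Set (EuclideanSpace ℝ (Fin d) × ℝ≥0)} {R : Ω → ℝ≥0}

lemma euclideanOutEdgeSum_eq_radialSum (A : Set (EuclideanSpace ℝ (Fin d) × ℝ≥0)) (ρ : ℝ≥0) :
    euclideanOutEdgeSum α A ρ = radialSum
      (fun x : EuclideanSpace ℝ (Fin d) × ℝ≥0 => dist x.1 0) α ρ (countingMeasureOf A) :=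
  outEdgeSum_eq_radialSum (len := fun x : EuclideanSpace ℝ (Fin d) => dist x 0) (by fun_prop) _ _ _

/-- Either the radius exceeds `a h`, or by monotonicity the sum at the deterministic radius `a h` is
above the threshold, which is `a ^ (-(α + d)) > 1` times its mean. A union bound finishes; the
minimum with `2` only meets the range of the Chernoff bound. -/
lemma euclideanOutEdgeSum_tail_le (hd : 0 < d) (hα : 0 ≤ α) (hX : IsMarkedPoissonProcess X ν P)
    (hR : HasLaw R ν P) {a h : ℝ} (ha : 0 < a) (ha1 : a < 1) (hh : 0 < h) :
    P.real {ω | ENNReal.ofReal (d * unitBallVolume d / (α + d) * h ^ (α + d)) <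
        euclideanOutEdgeSum α (X ω) (R ω)} ≤
      ν.real {r : ℝ≥0 | a * h < (r : ℝ)} +
        Real.exp (-(min (a ^ (-(α + d)) - 1) 2 ^ 2 / 4 *
          (d * unitBallVolume d / (α + d)) * a ^ d * h ^ d)) := by
  set c : ℝ := d * unitBallVolume d / (α + d) with hc
  have hd' : (0 : ℝ) < d := by exact_mod_cast hd
  have hc0 : 0 < c := by have := unitBallVolume_pos d; positivity
  let g : EuclideanSpace ℝ (Fin d) × ℝ≥0 → ℝ := fun x => dist x.1 0
  have hg : Measurable g := by fun_prop
  have hg0 (x) : 0 ≤ g x := dist_nonneg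
  have hΛ (r : ℝ) := prod_setOf_dist_le_ne_top (d := d) (ν := ν) r
  set δ : ℝ := min (a ^ (-(α + d)) - 1) 2 with hδ
  have hδ0 : 0 ≤ δ := by
    refine le_min (sub_nonneg.2 ?_) zero_le_two
    exact Real.one_le_rpow_of_pos_of_le_one_of_nonpos ha ha1.le (by linarith)
  have hah : 0 < a * h := mul_pos ha hh
  have hdev := IsPoissonProcess.measureReal_radialSum_ge_le hX hg hg0 hα hah (hΛ _) hδ0
    (min_le_right _ _)
  have hq : c * (a * h) ^ (α + d) / (a * h) ^ α = c * (a ^ d * h ^ d) := by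
    rw [mul_div_assoc, Real.rpow_add hah, mul_div_cancel_left₀ _ (Real.rpow_pos_of_pos hah α).ne',
      Real.rpow_natCast, mul_pow]
  rw [setIntegral_prod_norm_rpow hd hα hah.le, ← hc, hq] at hdev
  have hm : (1 + δ) * (c * (a * h) ^ (α + d)) ≤ c * h ^ (α + d) := by
    have : 1 + δ ≤ a ^ (-(α + d)) := by linarith [min_le_left (a ^ (-(α + d)) - 1) 2]
    refine (mul_le_mul_of_nonneg_right this (by positivity)).trans_eq ?_
    rw [Real.mul_rpow ha.le hh.le, Real.rpow_neg ha.le]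
    have := (Real.rpow_pos_of_pos ha (α + d)).ne'
    field_simp
  have hsub : {ω | ENNReal.ofReal (c * h ^ (α + d)) < euclideanOutEdgeSum α (X ω) (R ω)} ≤ᵐ[P]
      ({ω | a * h < R ω} ∪ {ω | (1 + δ) * (c * (a * h) ^ (α + d)) ≤
        (radialSum g α (a * h) (countingMeasureOf (X ω))).toReal} : Set Ω) := by
    filter_upwards [IsPoissonProcess.ae_radialSum_ne_top hX hg hg0 hα hΛ] with ω hω hlt
    by_cases hR' : a * h < R ω
    · exact Or.inl hR'
    · right
      have hlt' : ENNReal.ofReal (c * h ^ (α + d)) < euclideanOutEdgeSum α (X ω) (R ω) := hlt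
      rw [euclideanOutEdgeSum_eq_radialSum] at hlt'
      have h1 := hlt'.trans_le (radialSum_mono (not_lt.1 hR') _)
      have h2 := (ENNReal.ofReal_lt_iff_lt_toReal (by positivity) (hω _)).1 h1
      exact hm.trans h2.le
  refine (ENNReal.toReal_mono (measure_ne_top _ _) (measure_mono_ae hsub)).trans ?_
  refine (measureReal_union_le _ _).trans (add_le_add (measureReal_lt_radius hR _).le ?_)
  refine hdev.trans_eq ?_
  ring_nf

/-- It suffices that the radius exceeds `b h` and that the sum at radius `b h` stays above `b ^ (-(α
+ d)) < 1` times its mean, which is the threshold. These two events are independent. -/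
lemma le_euclideanOutEdgeSum_tail (hd : 0 < d) (hα : 0 ≤ α) (hX : IsMarkedPoissonProcess X ν P)
    (hR : HasLaw R ν P) (hRX : IndepFun R (fun ω => countingMeasureOf (X ω)) P)
    {b h : ℝ} (hb : 1 < b) (hh : 0 < h) :
    ν.real {r : ℝ≥0 | b * h < (r : ℝ)} * (1 -
        Real.exp (-((1 - b ^ (-(α + d))) ^ 2 / 4 *
          (d * unitBallVolume d / (α + d)) * b ^ d * h ^ d))) ≤
    P.real {ω | ENNReal.ofReal (d * unitBallVolume d / (α + d) * h ^ (α + d)) <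
        euclideanOutEdgeSum α (X ω) (R ω)} := by
  set c : ℝ := d * unitBallVolume d / (α + d) with hc
  have hd' : (0 : ℝ) < d := by exact_mod_cast hd
  have hc0 : 0 < c := by have := unitBallVolume_pos d; positivity
  let g : EuclideanSpace ℝ (Fin d) × ℝ≥0 → ℝ := fun x => dist x.1 0
  have hg : Measurable g := by fun_prop
  have hg0 (x) : 0 ≤ g x := dist_nonneg
  have hΛ (r : ℝ) := prod_setOf_dist_le_ne_top (d := d) (ν := ν) r
  have hb0 : 0 < b := by linarith
  have hbh : 0 < b * h := mul_pos hb0 hh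
  have hbp : 0 < b ^ (-(α + d)) := Real.rpow_pos_of_pos hb0 _
  have hbp1 : b ^ (-(α + d)) ≤ 1 := Real.rpow_le_one_of_one_le_of_nonpos hb.le (by linarith)
  have hdev := IsPoissonProcess.measureReal_radialSum_le_le hX hg hg0 hα hbh (hΛ _)
    (δ := 1 - b ^ (-(α + d))) (by linarith) (by linarith)
  rw [setIntegral_prod_norm_rpow hd hα hbh.le, ← hc, mul_div_assoc] at hdev
  have hm : (1 - (1 - b ^ (-(α + d)))) * (c * (b * h) ^ (α + d)) = c * h ^ (α + d) := by
    rw [Real.mul_rpow hb0.le hh.le, Real.rpow_neg hb0.le]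
    have := (Real.rpow_pos_of_pos hb0 (α + d)).ne'
    field_simp
    ring
  rw [hm, Real.rpow_add hbh, mul_div_cancel_left₀ _ (Real.rpow_pos_of_pos hbh α).ne',
    Real.rpow_natCast, mul_pow] at hdev
  let U : Set ℝ≥0 := {r | b * h < r}
  let V : Set (Measure (EuclideanSpace ℝ (Fin d) × ℝ≥0)) :=
    {μ | c * h ^ (α + d) < (radialSum g α (b * h) μ).toReal}
  have hU : MeasurableSet U := measurableSet_lt measurable_const (by fun_prop)
  have hV : MeasurableSet V :=
    measurableSet_lt measurable_const (measurable_radialSum hg _).ennreal_toReal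
  have hcompl : 1 - Real.exp (-((1 - b ^ (-(α + d))) ^ 2 / 4 * c * b ^ d * h ^ d)) ≤
      P.real ((fun ω => countingMeasureOf (X ω)) ⁻¹' V) := by
    have hVc : (fun ω => countingMeasureOf (X ω)) ⁻¹' V =
        {ω | (radialSum g α (b * h) (countingMeasureOf (X ω))).toReal ≤ c * h ^ (α + d)}ᶜ := by
      ext ω
      simp [V]
    have hm' : MeasurableSet {ω | (radialSum g α (b * h) (countingMeasureOf (X ω))).toReal ≤
        c * h ^ (α + d)} :=
      measurableSet_le ((measurable_radialSum hg _).comp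
        (IsPoissonProcess.measurable_count hX)).ennreal_toReal measurable_const
    rw [hVc, probReal_compl_eq_one_sub hm']
    refine sub_le_sub_left (hdev.trans_eq ?_) 1
    ring_nf
  have hind : P.real (R ⁻¹' U ∩ (fun ω => countingMeasureOf (X ω)) ⁻¹' V) =
      P.real (R ⁻¹' U) * P.real ((fun ω => countingMeasureOf (X ω)) ⁻¹' V) := by
    simp only [measureReal_def, hRX.measure_inter_preimage_eq_mul _ _ hU hV, ENNReal.toReal_mul]
  have hsub : (R ⁻¹' U ∩ (fun ω => countingMeasureOf (X ω)) ⁻¹' V : Set Ω) ≤ᵐ[P]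
      {ω | ENNReal.ofReal (c * h ^ (α + d)) < euclideanOutEdgeSum α (X ω) (R ω)} := by
    filter_upwards [IsPoissonProcess.ae_radialSum_ne_top hX hg hg0 hα hΛ] with ω hω hlt
    have h1 : c * h ^ (α + d) < (radialSum g α (b * h) (countingMeasureOf (X ω))).toReal := hlt.2
    have h2 := (ENNReal.ofReal_lt_iff_lt_toReal (by positivity) (hω _)).2 h1
    change ENNReal.ofReal _ < _
    rw [euclideanOutEdgeSum_eq_radialSum]
    exact h2.trans_le (radialSum_mono (le_of_lt hlt.1) _)
  calc
    _ ≤ ν.real {r : ℝ≥0 | b * h < (r : ℝ)} *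
          P.real ((fun ω => countingMeasureOf (X ω)) ⁻¹' V) :=
      mul_le_mul_of_nonneg_left hcompl measureReal_nonneg
    _ = P.real (R ⁻¹' U ∩ (fun ω => countingMeasureOf (X ω)) ⁻¹' V) := by
      rw [hind, ← measureReal_lt_radius hR]
      rfl
    _ ≤ _ := ENNReal.toReal_mono (measure_ne_top _ _) (measure_mono_ae hsub)

theorem tendsto_rpow_mul_euclideanOutEdgeSum_tail (hd : 0 < d) (hα : 0 ≤ α)
    (htail : Tendsto (fun h : ℝ => h ^ s * ν.real {r : ℝ≥0 | h < (r : ℝ)}) atTop (𝓝 β))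
    (hX : IsMarkedPoissonProcess X ν P)
    (hR : HasLaw R ν P) (hRX : IndepFun R (fun ω => countingMeasureOf (X ω)) P) :
    Tendsto (fun h : ℝ => h ^ s *
      P.real {ω | ENNReal.ofReal (d * unitBallVolume d / (α + d) * h ^ (α + d)) <
        euclideanOutEdgeSum α (X ω) (R ω)}) atTop (𝓝 β) := by
  have hd' : (0 : ℝ) < d := by exact_mod_cast hd
  have hαd : 0 < α + d := by linarith
  have hc0 : 0 < d * unitBallVolume d / (α + d) := by have := unitBallVolume_pos d; positivity
  refine tendsto_order.2 ⟨fun y hy => ?_, fun y hy => ?_⟩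
  · obtain ⟨b, hb, hby⟩ := exists_one_lt_lt_rpow_neg_mul hy s
    have hb0 : 0 < b := by linarith
    have hK : 0 < (1 - b ^ (-(α + d))) ^ 2 / 4 * (d * unitBallVolume d / (α + d)) * b ^ d := by
      have : b ^ (-(α + d)) < 1 := Real.rpow_lt_one_of_one_lt_of_neg hb (by linarith)
      have : 0 < 1 - b ^ (-(α + d)) := by linarith
      positivity
    have h1 := (tendsto_rpow_mul_tail htail hb0).mul
      -- Exponent `0` suffices: the error enters as a factor tending to `1`, not as a term
      -- multiplied by `h ^ s`.
      ((tendsto_rpow_mul_exp_neg_mul_pow 0 hK hd).const_sub 1)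
    rw [sub_zero, mul_one] at h1
    filter_upwards [h1.eventually_const_lt hby, eventually_gt_atTop 0] with h hlt hh
    refine hlt.trans_le ?_
    rw [Real.rpow_zero, one_mul, mul_assoc]
    exact mul_le_mul_of_nonneg_left (le_euclideanOutEdgeSum_tail hd hα hX hR hRX hb hh)
      (Real.rpow_nonneg hh.le _)
  · obtain ⟨a, ha, ha1, hay⟩ := exists_lt_one_rpow_neg_mul_lt hy s
    have hK : 0 < min (a ^ (-(α + d)) - 1) 2 ^ 2 / 4 *
        (d * unitBallVolume d / (α + d)) * a ^ d := by
      have : 1 < a ^ (-(α + d)) := Real.one_lt_rpow_of_pos_of_lt_one_of_neg ha ha1 (by linarith)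
      have : 0 < min (a ^ (-(α + d)) - 1) 2 := lt_min (by linarith) two_pos
      positivity
    have h1 := (tendsto_rpow_mul_tail htail ha).add (tendsto_rpow_mul_exp_neg_mul_pow s hK hd)
    rw [add_zero] at h1
    filter_upwards [h1.eventually_lt_const hay, eventually_gt_atTop 0] with h hlt hh
    refine lt_of_le_of_lt ?_ hlt
    rw [← mul_add]
    exact mul_le_mul_of_nonneg_left (euclideanOutEdgeSum_tail_le hd hα hX hR ha ha1 hh)
      (Real.rpow_nonneg hh.le _)

end EuclideanTail

theorem theorem1 {d : ℕ} (hd : 2 ≤ d)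
    -- the distribution of the typical radius
    (ν : Measure ℝ≥0) [IsProbabilityMeasure ν]
    (hν : ν.map (fun r : ℝ≥0 => (r : ℝ)) ≪ volume)
    {s β : ℝ} (hs : 0 < s) (hβ : 0 < β)
    (htail : Tendsto (fun h : ℝ => h ^ s * ν.real {r : ℝ≥0 | h < (r : ℝ)}) atTop (𝓝 β))
    -- the marked Poisson processes on the tori, and the independent radii at the origin
    {Ω : ℕ+ → Type*} [∀ n, MeasurableSpace (Ω n)] (P : ∀ n, Measure (Ω n))
    [∀ n, IsProbabilityMeasure (P n)]
    (X : ∀ n, Ω n → Set (Torus d n × ℝ≥0)) (hX : ∀ n, IsMarkedPoissonProcess (X n) ν (P n))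
    (R : ∀ n, Ω n → ℝ≥0) (hR : ∀ n, HasLaw (R n) ν (P n))
    (hRX : ∀ n, IndepFun (R n) (fun ω => countingMeasureOf (X n ω)) (P n))
    -- the marked Poisson process on the whole space, and the independent radius at the origin
    {Ω' : Type*} [MeasurableSpace Ω'] (P' : Measure Ω') [IsProbabilityMeasure P']
    (X' : Ω' → Set (EuclideanSpace ℝ (Fin d) × ℝ≥0)) (hX' : IsMarkedPoissonProcess X' ν P')
    (R' : Ω' → ℝ≥0) (hR' : HasLaw R' ν P')
    (hRX' : IndepFun R' (fun ω => countingMeasureOf (X' ω)) P')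
    (α : ℝ) (hα : 0 < α) :
    (∀ n, ∀ᵐ ω ∂(P n), torusOutEdgeSum α (X n ω) (R n ω) ≠ ∞) ∧
    (∀ᵐ ω ∂P', euclideanOutEdgeSum α (X' ω) (R' ω) ≠ ∞) ∧
    TendstoInDistribution (fun n ω => (torusOutEdgeSum α (X n ω) (R n ω)).toReal) atTop
      (fun ω => (euclideanOutEdgeSum α (X' ω) (R' ω)).toReal) P P' ∧
    Tendsto (fun t : ℝ => t ^ (s / (α + d)) *
        P'.real {ω | ENNReal.ofReal t < euclideanOutEdgeSum α (X' ω) (R' ω)}) atTop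
      (𝓝 ((d * unitBallVolume d / (α + d)) ^ (s / (α + d)) * β)) := by
  have hd0 : 0 < d := by omega
  have hd' : (0 : ℝ) < d := by exact_mod_cast hd0
  have hαd : 0 < α + d := by linarith
  refine ⟨fun n => ?_, ?_, tendstoInDistribution_torusOutEdgeSum hX hR hRX hX' hR' hRX' hα.le, ?_⟩
  · filter_upwards [IsPoissonProcess.ae_radialSum_ne_top (hX n)
      (g := fun x : Torus d n × ℝ≥0 => torusDist x.1 0)
      (measurable_torusDist.comp measurable_fst) (fun _ => torusDist_nonneg _) hα.le
      prod_setOf_torusDist_le_ne_top] with ω hω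
    rw [torusOutEdgeSum, outEdgeSum_eq_radialSum measurable_torusDist]
    exact hω _
  · filter_upwards [IsPoissonProcess.ae_radialSum_ne_top hX'
      (g := fun x : EuclideanSpace ℝ (Fin d) × ℝ≥0 => dist x.1 0)
      (by fun_prop) (fun _ => dist_nonneg) hα.le prod_setOf_dist_le_ne_top] with ω hω
    rw [euclideanOutEdgeSum_eq_radialSum]
    exact hω _
  · set c : ℝ := d * unitBallVolume d / (α + d) with hc
    have hc0 : 0 < c := by have := unitBallVolume_pos d; positivity
    -- Substituting `h = (t / c) ^ (1 / (α + d))` makes the threshold `c h ^ (α + d)` equal to `t`,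
    -- and `h ^ s` produces the constant `c ^ (s / (α + d))`.
    have hlim : Tendsto (fun t : ℝ => (t / c) ^ (1 / (α + d))) atTop atTop :=
      (tendsto_rpow_atTop (by positivity)).comp (tendsto_id.atTop_div_const hc0)
    refine (((tendsto_rpow_mul_euclideanOutEdgeSum_tail hd0 hα.le htail hX' hR' hRX').comp
      hlim).const_mul (c ^ (s / (α + d)))).congr' ?_
    filter_upwards [eventually_gt_atTop 0] with t ht
    have htc : 0 ≤ t / c := by positivity
    have e1 : ((t / c) ^ (1 / (α + d))) ^ s = (t / c) ^ (s / (α + d)) := by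
      rw [← Real.rpow_mul htc]
      congr 1
      ring
    have e2 : c * ((t / c) ^ (1 / (α + d))) ^ (α + d) = t := by
      rw [← Real.rpow_mul htc, one_div_mul_cancel hαd.ne', Real.rpow_one]
      field_simp
    simp only [Function.comp_apply]
    rw [← hc, e1, e2, ← mul_assoc, ← Real.mul_rpow hc0.le htc, mul_div_cancel₀ _ hc0.ne']
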